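/- All graphs are finite and simple. For a graph $G$ let $v(G)$ and $e(G)$ denote its numbers of vertices and edges. A graph $G$ is \emph{4-critical} if its chromatic number is $4$ and every proper subgraph of $G$ has chromatic number at most $3$. Let $K_4$ be the complete graph on four vertices, and let $W_6$ be the wheel on six vertices, that is, the graph obtained from a cycle on five vertices by adding one new vertex adjacent to all vertices of the cycle. The complement $\bar G$ of $G$ is the graph on the same vertex set in which two distinct vertices are adjacent if and only if they are not adjacent in $G$. Theorem. If $G$ is a $4$-critical graph that is isomorphic neither to $K_4$ nor to $W_6$, and $$e(G) < \frac{17\,v(G)}{10},$$ then $\bar G$ contains a Hamiltonian cycle, i.e. a cycle passing through every vertex exactly once. -/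

import Mathlib

namespace SparseCritical

/-- A graph `G` is `k`-critical if its chromatic number is `k` and every proper subgraph
(some vertices or edges missing) has chromatic number smaller than `k`. -/
def IsCritical {V : Type*} (G : SimpleGraph V) (k : ℕ) : Prop :=
  G.chromaticNumber = (k : ℕ∞) ∧
    ∀ H : G.Subgraph, H ≠ ⊤ → H.coe.chromaticNumber < (k : ℕ∞)

/-- The wheel `W_n` on `n` vertices (`4 ≤ n`): a cycle on the `n - 1` vertices `some i`,
together with a hub `none` adjacent to all of them. -/
def wheelGraph (n : ℕ) : SimpleGraph (Option (Fin (n - 1))) where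
  Adj x y :=
    match x, y with
    | none, none => False
    | none, some _ => True
    | some _, none => True
    | some i, some j => (SimpleGraph.cycleGraph (n - 1)).Adj i j
  symm := ⟨by
    rintro (_ | i) (_ | j) h
    · exact h
    · trivial
    · trivial
    · exact SimpleGraph.Adj.symm h⟩
  loopless := ⟨by
    rintro (_ | i) h
    · exact h
    · exact SimpleGraph.irrefl _ h⟩

end SparseCritical

/-! Criticality enters only through two consequences: all degrees are at least 3, and `G` is not
3-colourable. Write `s = 2e - 3n` for the total excess of the degrees over 3; sparsity says `s <
2n/5`.

For `n ≥ 8` colourings play no role. If `Gᶜ` were not Hamiltonian, extend it to a maximal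
non-Hamiltonian graph `H`. By the Bondy–Chvátal closure step, nonadjacent vertices of `H` have
degree sum below `n`, so the edges of `F = Hᶜ ≤ G` have `F`-degree sum at least `n - 1`. A vertex of
least positive `F`-degree `p` then has `p` neighbours of degree at least `max (n - 1 - p) p` in `G`,
and their excess alone exceeds `s` (`exists_isCyclicOrder_compl_of_sparse`).

For `n ≤ 7` the degree and edge bounds leave few graphs: `K_4`, `W_6`, 3-colourable graphs, and
graphs on seven vertices with Hamiltonian complement. Exhaustive checks over adjacency matrices
settle these. -/

namespace SparseCritical

open SimpleGraph

/-! ### Hamiltonian cycles as cyclic orders of the vertices. -/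

/-- `f 0, …, f (n - 1)` are distinct vertices which form a cycle of `G` in this order. -/
structure IsCyclicOrder {V : Type*} (G : SimpleGraph V) (n : ℕ) (f : ℕ → V) : Prop where
  inj : ∀ i < n, ∀ j < n, f i = f j → i = j
  adj : ∀ i, i + 1 < n → G.Adj (f i) (f (i + 1))
  close : G.Adj (f (n - 1)) (f 0)

theorem IsCyclicOrder.isContained {V : Type*} {G : SimpleGraph V} {n : ℕ} (hn : 3 ≤ n)
    {f : ℕ → V} (h : IsCyclicOrder G n f) : cycleGraph n ⊑ G := by
  -- A difference of 1 modulo `n` is either a genuine successor or the wrap-around from `n - 1` to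
  -- `0`.
  have key : ∀ x y : Fin n, (x - y).val = 1 → G.Adj (f y) (f x) := by
    intro x y hxy
    rcases le_or_gt y x with hle | hlt
    · rw [Fin.sub_val_of_le hle] at hxy
      have hx : x.val = y.val + 1 := by omega
      rw [hx]
      exact h.adj _ (by omega)
    · rw [Fin.coe_sub_iff_lt.mpr hlt] at hxy
      have hy : y.val = n - 1 := by omega
      have hx : x.val = 0 := by omega
      rw [hx, hy]
      exact h.close
  refine ⟨⟨⟨fun i => f i, ?_⟩, ?_⟩⟩
  · intro x y hxy
    rcases cycleGraph_adj'.mp hxy with hxy | hxy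
    · exact (key x y hxy).symm
    · exact key y x hxy
  · intro x y hxy
    exact Fin.ext (h.inj _ x.2 _ y.2 hxy)

theorem IsCyclicOrder.exists_isHamiltonianCycle {V : Type*} [Fintype V] [DecidableEq V]
    {G : SimpleGraph V} (hn : 3 ≤ Fintype.card V) {f : ℕ → V}
    (h : IsCyclicOrder G (Fintype.card V) f) :
    ∃ (a : V) (p : G.Walk a a), p.IsHamiltonianCycle := by
  obtain ⟨a, p, hp, hl⟩ := (cycleGraph_isContained_iff hn).mp (h.isContained hn)
  exact ⟨a, p, Walk.isHamiltonianCycle_iff_isCycle_and_length_eq.mpr ⟨hp, hl⟩⟩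

/-- Starting the cycle at `f (k + 1)` turns its edge from `f k` to `f (k + 1)` into the closing
edge. -/
theorem IsCyclicOrder.shift {V : Type*} {G : SimpleGraph V} {n : ℕ} {f : ℕ → V}
    (h : IsCyclicOrder G n f) {k : ℕ} (hk : k + 1 < n) :
    IsCyclicOrder G n (fun i => if i + k + 1 < n then f (i + k + 1) else f (i + k + 1 - n)) where
  inj i hi j hj hij := by
    split_ifs at hij with h1 h2 h2 <;> have := h.inj _ (by omega) _ (by omega) hij <;> omega
  adj i hi := by
    split_ifs with h1 h2 h2
    · have := h.adj (i + k + 1) (by omega)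
      rwa [show i + 1 + k + 1 = i + k + 1 + 1 by omega]
    · have := h.close
      rwa [show i + k + 1 = n - 1 by omega, show i + 1 + k + 1 - n = 0 by omega]
    · omega
    · have := h.adj (i + k + 1 - n) (by omega)
      rwa [show i + 1 + k + 1 - n = i + k + 1 - n + 1 by omega]
  close := by
    rw [if_neg (by omega), if_pos (by omega), show n - 1 + k + 1 - n = k by omega,
      show 0 + k + 1 = k + 1 by omega]
    exact h.adj k hk

theorem IsCyclicOrder.mono {V : Type*} {G H : SimpleGraph V} {n : ℕ} {f : ℕ → V}
    (h : IsCyclicOrder G n f) (h1 : ∀ i, i + 1 < n → H.Adj (f i) (f (i + 1)))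
    (h2 : H.Adj (f (n - 1)) (f 0)) : IsCyclicOrder H n f :=
  ⟨h.inj, h1, h2⟩

/-! ### Bondy–Chvátal closure. -/

/-- Pósa rotation: a spanning path whose ends have degree sum at least `n` closes to a cycle. -/
theorem exists_isCyclicOrder_of_path {V : Type*} [Fintype V] {H : SimpleGraph V}
    [DecidableRel H.Adj] (hn : 3 ≤ Fintype.card V) {f : ℕ → V}
    (inj : ∀ i < Fintype.card V, ∀ j < Fintype.card V, f i = f j → i = j)
    (adj : ∀ i, i + 1 < Fintype.card V → H.Adj (f i) (f (i + 1)))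
    (hdeg : Fintype.card V ≤ H.degree (f 0) + H.degree (f (Fintype.card V - 1))) :
    ∃ g, IsCyclicOrder H (Fintype.card V) g := by
  classical
  set n := Fintype.card V with hnV
  have hsurj : ∀ v, ∃ i < n, f i = v := by
    have hb : Function.Bijective (fun i : Fin n => f i) := by
      rw [Fintype.bijective_iff_injective_and_card]
      exact ⟨fun i j hij => Fin.ext (inj _ i.2 _ j.2 hij), by simp [hnV]⟩
    intro v
    obtain ⟨i, hi⟩ := hb.2 v
    exact ⟨i, i.2, hi⟩
  set S := (Finset.range (n - 1)).filter (fun i => H.Adj (f 0) (f (i + 1)))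
  set T := (Finset.range (n - 1)).filter (fun i => H.Adj (f (n - 1)) (f i))
  have hS : H.degree (f 0) ≤ S.card := by
    rw [← card_neighborFinset_eq_degree]
    refine (Finset.card_le_card ?_).trans (Finset.card_image_le (f := fun i => f (i + 1)))
    intro v hv
    rw [mem_neighborFinset] at hv
    obtain ⟨i, hi, rfl⟩ := hsurj v
    have hi0 : i ≠ 0 := fun h => by subst h; exact H.irrefl hv
    refine Finset.mem_image.mpr ⟨i - 1, Finset.mem_filter.mpr ⟨?_, ?_⟩, ?_⟩
    · simp only [Finset.mem_range]; omega
    · rwa [Nat.sub_add_cancel (by omega)]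
    · rw [Nat.sub_add_cancel (by omega)]
  have hT : H.degree (f (n - 1)) ≤ T.card := by
    rw [← card_neighborFinset_eq_degree]
    refine (Finset.card_le_card ?_).trans (Finset.card_image_le (f := f))
    intro v hv
    rw [mem_neighborFinset] at hv
    obtain ⟨i, hi, rfl⟩ := hsurj v
    have hi0 : i ≠ n - 1 := fun h => by subst h; exact H.irrefl hv
    refine Finset.mem_image.mpr ⟨i, Finset.mem_filter.mpr ⟨?_, hv⟩, rfl⟩
    simp only [Finset.mem_range]; omega
  -- Pigeonhole: `S` and `T` have at least `n` elements together but lie in a set of size `n - 1`.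
  obtain ⟨k, hk⟩ : (S ∩ T).Nonempty := by
    rw [← Finset.card_pos]
    have h1 := Finset.card_union_add_card_inter S T
    have h2 : (S ∪ T).card ≤ n - 1 := by
      rw [← Finset.card_range (n - 1)]
      exact Finset.card_le_card (Finset.union_subset (Finset.filter_subset _ _)
        (Finset.filter_subset _ _))
    omega
  simp only [S, T, Finset.mem_inter, Finset.mem_filter, Finset.mem_range] at hk
  obtain ⟨⟨hkn, hk0⟩, -, hkl⟩ := hk
  -- The part of the path after `k` is reversed: `f 0, …, f k, f (n - 1), …, f (k + 1)`, closing up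
  -- at `f 0`.
  refine ⟨fun i => if i ≤ k then f i else f (n + k - i), ?_, ?_, ?_⟩
  · intro i hi j hj hij
    split_ifs at hij <;> have := inj _ (by omega) _ (by omega) hij <;> omega
  · intro i hi
    split_ifs with h1 h2 h2
    · exact adj i hi
    · rw [show i = k by omega, show n + k - (k + 1) = n - 1 by omega]
      exact hkl.symm
    · omega
    · have := adj (n + k - (i + 1)) (by omega)
      rw [show n + k - (i + 1) + 1 = n + k - i by omega] at this
      exact this.symm
  · rw [if_neg (by omega), if_pos (by omega), show n + k - (n - 1) = k + 1 by omega]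
    exact hk0.symm

/-- The Bondy–Chvátal closure step. -/
theorem exists_isCyclicOrder_of_sup_edge {V : Type*} [Fintype V] {H : SimpleGraph V}
    [DecidableRel H.Adj] (hn : 3 ≤ Fintype.card V) {u v : V}
    (hdeg : Fintype.card V ≤ H.degree u + H.degree v) {f : ℕ → V}
    (hf : IsCyclicOrder (H ⊔ edge u v) (Fintype.card V) f) :
    ∃ g, IsCyclicOrder H (Fintype.card V) g := by
  set n := Fintype.card V with hnV
  have hadj : ∀ {x y}, (H ⊔ edge u v).Adj x y → ¬ H.Adj x y →
      (x = u ∧ y = v) ∨ (x = v ∧ y = u) := by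
    intro x y h h'
    simp only [sup_adj, edge_adj] at h
    tauto
  -- If the new edge closes the cycle, it occurs nowhere else because `n ≥ 3`, so the rest is a
  -- spanning path of `H` with ends `u` and `v`.
  have hclosed : ∀ g, IsCyclicOrder (H ⊔ edge u v) n g → ¬ H.Adj (g (n - 1)) (g 0) →
      ∃ g, IsCyclicOrder H n g := by
    intro g hg hne
    have h0 := hadj hg.close hne
    refine exists_isCyclicOrder_of_path hn hg.inj (fun i hi => ?_) ?_
    · by_contra hni
      have hi' := hadj (hg.adj i hi) hni
      rcases h0 with ⟨a, b⟩ | ⟨a, b⟩ <;> rcases hi' with ⟨c, d⟩ | ⟨c, d⟩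
      all_goals
        first
        | (have e1 := hg.inj _ (by omega) _ (by omega) (a.trans c.symm)
           omega)
        | (have e1 := hg.inj _ (by omega) _ (by omega) (a.trans d.symm)
           have e2 := hg.inj _ (by omega) _ (by omega) (b.trans c.symm)
           omega)
    · rcases h0 with ⟨a, b⟩ | ⟨a, b⟩ <;> rw [← hnV, a, b] <;> omega
  by_cases hc : H.Adj (f (n - 1)) (f 0)
  · by_cases hall : ∀ i, i + 1 < n → H.Adj (f i) (f (i + 1))
    · exact ⟨f, hf.mono hall hc⟩
    · push Not at hall
      obtain ⟨k, hk, hne⟩ := hall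
      refine hclosed _ (hf.shift hk) ?_
      rwa [if_neg (by omega), if_pos (by omega), show n - 1 + k + 1 - n = k by omega,
        show 0 + k + 1 = k + 1 by omega]
  · exact hclosed f hf hc

theorem exists_isCyclicOrder_top {V : Type*} [Fintype V] (hn : 3 ≤ Fintype.card V) :
    ∃ g, IsCyclicOrder (⊤ : SimpleGraph V) (Fintype.card V) g := by
  set n := Fintype.card V
  let e := (Fintype.equivFin V).symm
  have hinj : ∀ i (hi : i < n) j (hj : j < n), e ⟨i, hi⟩ = e ⟨j, hj⟩ → i = j := by
    intro i hi j hj h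
    simpa using e.injective h
  refine ⟨fun i => if h : i < n then e ⟨i, h⟩ else e ⟨0, by omega⟩, ?_, ?_, ?_⟩
  · intro i hi j hj hij
    simp only [hi, hj, dif_pos] at hij
    exact hinj _ _ _ _ hij
  · intro i hi
    rw [top_adj, dif_pos hi, dif_pos (by omega)]
    intro h
    have := hinj _ _ _ _ h
    omega
  · rw [top_adj, dif_pos (by omega), dif_pos (by omega)]
    intro h
    have := hinj _ _ _ _ h
    omega

/-- If `K` has no Hamiltonian cycle then some nonempty subgraph `F` of the complement of `K`
has all its edges of degree sum at least `n - 1`. -/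
theorem exists_le_compl_degree_add_degree {V : Type*} [Fintype V] (K : SimpleGraph V)
    (hn : 3 ≤ Fintype.card V) (hK : ¬ ∃ g, IsCyclicOrder K (Fintype.card V) g) :
    ∃ (F : SimpleGraph V) (_ : DecidableRel F.Adj), F ≤ Kᶜ ∧ F ≠ ⊥ ∧
      ∀ u v, F.Adj u v → Fintype.card V ≤ F.degree u + F.degree v + 1 := by
  classical
  -- In a maximal non-Hamiltonian `H`, adding any missing edge creates a Hamiltonian cycle, so the
  -- closure step bounds the degree sum of its ends by `n - 1`.
  obtain ⟨H, hKH, hH⟩ := Finite.exists_le_maximal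
    (p := fun H : SimpleGraph V => ¬ ∃ g, IsCyclicOrder H (Fintype.card V) g) hK
  refine ⟨Hᶜ, inferInstance, compl_le_compl hKH, ?_, ?_⟩
  · intro h
    rw [compl_eq_bot] at h
    subst h
    exact hH.1 (exists_isCyclicOrder_top hn)
  · intro u v huv
    rw [compl_adj] at huv
    by_contra hlt
    have hu := H.degree_compl u
    have hv := H.degree_compl v
    have hu' := H.degree_lt_card_verts u
    have hv' := H.degree_lt_card_verts v
    have hnot : ∃ g, IsCyclicOrder (H ⊔ edge u v) (Fintype.card V) g := by
      by_contra hno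
      have := hH.2 hno le_sup_left
      exact huv.2 (this (by simp [edge_adj, huv.1]))
    obtain ⟨g, hg⟩ := hnot
    exact hH.1 (exists_isCyclicOrder_of_sup_edge hn (by omega) hg)

/-! ### Sparse graphs on at least eight vertices. -/

theorem sum_degree_sub_three {V : Type*} [Fintype V] (G : SimpleGraph V) [DecidableRel G.Adj]
    (h3 : ∀ v, 3 ≤ G.degree v) :
    ∑ v, (G.degree v - 3) + 3 * Fintype.card V = 2 * G.edgeFinset.card := by
  rw [← G.sum_degrees_eq_twice_card_edges, mul_comm, ← Finset.card_univ, ← smul_eq_mul,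
    ← Finset.sum_const, ← Finset.sum_add_distrib]
  exact Finset.sum_congr rfl fun v _ => Nat.sub_add_cancel (h3 v)

theorem exists_isCyclicOrder_compl_of_sparse {V : Type*} [Fintype V] (G : SimpleGraph V)
    [DecidableRel G.Adj] (h3 : ∀ v, 3 ≤ G.degree v) (hn : 8 ≤ Fintype.card V)
    (he : 10 * G.edgeFinset.card < 17 * Fintype.card V) :
    ∃ g, IsCyclicOrder Gᶜ (Fintype.card V) g := by
  classical
  by_contra hno
  obtain ⟨F, _, hFG, hF, hsum⟩ := exists_le_compl_degree_add_degree Gᶜ (by omega) hno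
  rw [compl_compl] at hFG
  obtain ⟨u₀, v₀, huv₀⟩ := ne_bot_iff_exists_adj.mp hF
  obtain ⟨u, hu, hmin⟩ := Finset.exists_min_image (Finset.univ.filter fun v => 0 < F.degree v)
    (fun v => F.degree v)
    ⟨u₀, by simpa using (F.degree_pos_iff_exists_adj u₀).mpr ⟨v₀, huv₀⟩⟩
  simp only [Finset.mem_filter, Finset.mem_univ, true_and] at hu hmin
  set n := Fintype.card V
  set p := F.degree u
  -- Each `F`-neighbour of `u` has degree at least `q`: `n - 1 - p` comes from the degree sum along
  -- the edge, `p` from minimality.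
  obtain ⟨q, hq⟩ : ∃ q, q = max (n - 1 - p) p := ⟨_, rfl⟩
  have hbound : p * (q - 3) ≤ ∑ v, (G.degree v - 3) := by
    have h1 : ∑ v ∈ F.neighborFinset u, (q - 3) ≤ ∑ v ∈ F.neighborFinset u, (G.degree v - 3) := by
      refine Finset.sum_le_sum fun w hw => Nat.sub_le_sub_right ?_ 3
      rw [mem_neighborFinset] at hw
      have ha := hsum u w hw
      have hb := hmin w ((F.degree_pos_iff_exists_adj w).mpr ⟨u, hw.symm⟩)
      have hc : F.degree w ≤ G.degree w := degree_le_of_le hFG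
      omega
    rw [Finset.sum_const, card_neighborFinset_eq_degree, smul_eq_mul] at h1
    exact h1.trans (Finset.sum_le_univ_sum_of_nonneg fun _ => Nat.zero_le _)
  have hs := sum_degree_sub_three G h3
  set s := ∑ v, (G.degree v - 3)
  have hq1 : n ≤ p + q + 1 := by omega
  have hq2 : p ≤ q := by omega
  rcases Nat.lt_or_ge p 4 with hp | hp
  -- Here `8 ≤ n` matters: for `n = 8`, `p = 1`, integrality gives `e ≤ 13` and `s ≤ 2`, against `s
  -- ≥ 3`.
  · interval_cases p <;> omega
  · clear_value p
    obtain ⟨a, rfl⟩ := Nat.exists_eq_add_of_le hp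
    obtain ⟨b, rfl⟩ := Nat.exists_eq_add_of_le (show 4 ≤ q by omega)
    rw [show 4 + b - 3 = b + 1 by omega] at hbound
    -- With `n ≤ a + b + 9`, sparsity gives `5 * s < 2 * (a + b + 9)`, which is incompatible with
    -- this bound.
    have : a * b + a + 4 * b + 4 ≤ s := by nlinarith
    have := Nat.zero_le (a * b)
    omega

/-! ### Minimum degree of critical graphs. -/

/-- A `(k + 1)`-critical graph has minimum degree at least `k`. -/
theorem le_degree_of_isCritical {V : Type*} [Fintype V] {G : SimpleGraph V}
    [DecidableRel G.Adj] {k : ℕ} (h : IsCritical G (k + 1)) (v : V) : k ≤ G.degree v := by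
  classical
  by_contra! hlt
  have hne : G.induce {v}ᶜ |>.Colorable k := by
    have hsub := h.2 ((⊤ : G.Subgraph).deleteVerts {v}) (by
      intro he
      have : v ∈ ((⊤ : G.Subgraph).deleteVerts {v}).verts := by rw [he]; trivial
      simp at this)
    have hcol : ((⊤ : G.Subgraph).deleteVerts {v}).coe.Colorable k := by
      rw [← chromaticNumber_le_iff_colorable]
      exact Order.le_of_lt_add_one (by exact_mod_cast hsub)
    refine hcol.of_hom (⟨fun x => ⟨x.1, trivial, x.2⟩, ?_⟩ : _ →g _)
    intro a b hab
    simp only [comap_adj, Function.Embedding.subtype_apply] at hab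
    have ha : a.1 ≠ v := a.2
    have hb : b.1 ≠ v := b.2
    simp [hab, ha, hb]
  obtain ⟨c⟩ := hne
  -- Fewer than `k` neighbours leave a colour free for `v`; otherwise a choice of one neighbour per
  -- colour would be injective.
  have hused : ∃ x : Fin k, ∀ w (hw : w ≠ v), G.Adj v w → c ⟨w, hw⟩ ≠ x := by
    by_contra! hall
    choose w hw hadj hc using hall
    have hinj : Function.Injective w := by
      intro x y hxy
      rw [← hc x, ← hc y]
      congr 2
    have := Finset.card_le_card (s := Finset.univ.image w) (t := G.neighborFinset v) (by
      intro y hy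
      obtain ⟨x, -, rfl⟩ := Finset.mem_image.mp hy
      rw [mem_neighborFinset]
      exact hadj x)
    rw [Finset.card_image_of_injective _ hinj, Finset.card_univ, Fintype.card_fin,
      card_neighborFinset_eq_degree] at this
    omega
  obtain ⟨x, hx⟩ := hused
  have hcolor : G.Colorable k := by
    refine ⟨Coloring.mk (fun w => if hw : w = v then x else c ⟨w, hw⟩) ?_⟩
    intro a b hab
    split_ifs with h1 h2 h2
    · exact absurd (h1.trans h2.symm) hab.ne
    · subst h1
      exact (hx b h2 hab).symm
    · subst h2
      exact hx a h1 hab.symm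
    · exact c.valid (by simpa using hab)
  have := chromaticNumber_le_iff_colorable.mpr hcolor
  rw [h.1] at this
  norm_cast at this
  omega

/-! ### Exhaustive checks over adjacency matrices. -/

-- The complement has maximum degree at most 1 and at least two edges; these two disjoint edges and
-- the fifth vertex are the colour classes. Each degree condition follows the last entry of its row,
-- which prunes the search, and vertex `0` has colour `0` by symmetry.
set_option maxRecDepth 100000 in
set_option synthInstance.maxHeartbeats 0 in
set_option synthInstance.maxSize 100000000 in
theorem three_coloring_of_five : ∀ b01 b02 b03 b04 : Bool,
    3 ≤ b01.toNat + b02.toNat + b03.toNat + b04.toNat →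
    ∀ b12 b13 b14 : Bool, 3 ≤ b01.toNat + b12.toNat + b13.toNat + b14.toNat →
    ∀ b23 b24 : Bool, 3 ≤ b02.toNat + b12.toNat + b23.toNat + b24.toNat →
    ∀ b34 : Bool, 3 ≤ b03.toNat + b13.toNat + b23.toNat + b34.toNat →
    3 ≤ b04.toNat + b14.toNat + b24.toNat + b34.toNat →
    b01.toNat + b02.toNat + b03.toNat + b04.toNat + b12.toNat + b13.toNat +
      b14.toNat + b23.toNat + b24.toNat + b34.toNat ≤ 8 →
      ∃ c1 : Fin 3, (b01 = true → c1 ≠ 0) ∧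
      ∃ c2 : Fin 3, (b02 = true → c2 ≠ 0) ∧ (b12 = true → c2 ≠ c1) ∧
      ∃ c3 : Fin 3, (b03 = true → c3 ≠ 0) ∧ (b13 = true → c3 ≠ c1) ∧ (b23 = true → c3 ≠ c2) ∧
      ∃ c4 : Fin 3, (b04 = true → c4 ≠ 0) ∧ (b14 = true → c4 ≠ c1) ∧ (b24 = true → c4 ≠ c2) ∧
        (b34 = true → c4 ≠ c3) := by
  decide +kernel

-- The complement has degrees 1 or 2 and at least five edges, hence at most one path component. It
-- is a 6-vertex path or cycle, a 4-cycle with an edge, or a triangle with a triangle or a 3-vertex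
-- path; each splits into at most three cliques.
set_option maxRecDepth 100000 in
set_option synthInstance.maxHeartbeats 0 in
set_option synthInstance.maxSize 100000000 in
theorem three_coloring_of_six : ∀ b01 b02 b03 b04 b05 : Bool,
    (3 ≤ b01.toNat + b02.toNat + b03.toNat + b04.toNat + b05.toNat ∧
      b01.toNat + b02.toNat + b03.toNat + b04.toNat + b05.toNat ≤ 4) →
    ∀ b12 b13 b14 b15 : Bool,
    (3 ≤ b01.toNat + b12.toNat + b13.toNat + b14.toNat + b15.toNat ∧
      b01.toNat + b12.toNat + b13.toNat + b14.toNat + b15.toNat ≤ 4) →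
    ∀ b23 b24 b25 : Bool,
    (3 ≤ b02.toNat + b12.toNat + b23.toNat + b24.toNat + b25.toNat ∧
      b02.toNat + b12.toNat + b23.toNat + b24.toNat + b25.toNat ≤ 4) →
    ∀ b34 b35 : Bool,
    (3 ≤ b03.toNat + b13.toNat + b23.toNat + b34.toNat + b35.toNat ∧
      b03.toNat + b13.toNat + b23.toNat + b34.toNat + b35.toNat ≤ 4) →
    ∀ b45 : Bool,
    (3 ≤ b04.toNat + b14.toNat + b24.toNat + b34.toNat + b45.toNat ∧
      b04.toNat + b14.toNat + b24.toNat + b34.toNat + b45.toNat ≤ 4) →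
    (3 ≤ b05.toNat + b15.toNat + b25.toNat + b35.toNat + b45.toNat ∧
      b05.toNat + b15.toNat + b25.toNat + b35.toNat + b45.toNat ≤ 4) →
    b01.toNat + b02.toNat + b03.toNat + b04.toNat + b05.toNat + b12.toNat + b13.toNat +
      b14.toNat + b15.toNat + b23.toNat + b24.toNat + b25.toNat + b34.toNat + b35.toNat +
      b45.toNat ≤ 10 →
      ∃ c1 : Fin 3, (b01 = true → c1 ≠ 0) ∧
      ∃ c2 : Fin 3, (b02 = true → c2 ≠ 0) ∧ (b12 = true → c2 ≠ c1) ∧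
      ∃ c3 : Fin 3, (b03 = true → c3 ≠ 0) ∧ (b13 = true → c3 ≠ c1) ∧ (b23 = true → c3 ≠ c2) ∧
      ∃ c4 : Fin 3, (b04 = true → c4 ≠ 0) ∧ (b14 = true → c4 ≠ c1) ∧ (b24 = true → c4 ≠ c2) ∧
        (b34 = true → c4 ≠ c3) ∧
      ∃ c5 : Fin 3, (b05 = true → c5 ≠ 0) ∧ (b15 = true → c5 ≠ c1) ∧ (b25 = true → c5 ≠ c2) ∧
        (b35 = true → c5 ≠ c3) ∧ (b45 = true → c5 ≠ c4) := by
  decide +kernel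

set_option maxRecDepth 100000 in
/-- A graph on five vertices which is regular of degree two is a 5-cycle. -/
theorem five_cycle_of_two_regular : ∀ b12 b13 b14 b15 b23 b24 b25 b34 b35 b45 : Bool,
    b12.toNat + b13.toNat + b14.toNat + b15.toNat = 2 →
    b12.toNat + b23.toNat + b24.toNat + b25.toNat = 2 →
    b13.toNat + b23.toNat + b34.toNat + b35.toNat = 2 →
    b14.toNat + b24.toNat + b34.toNat + b45.toNat = 2 →
    b15.toNat + b25.toNat + b35.toNat + b45.toNat = 2 →
    -- These are the 12 = 4!/2 undirected 5-cycles; index `i` stands for the vertex labelled `i +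
    -- 1`.
    ∃ σ ∈ ([![0, 1, 2, 3, 4], ![0, 1, 2, 4, 3], ![0, 1, 3, 2, 4], ![0, 1, 3, 4, 2],
      ![0, 1, 4, 2, 3], ![0, 1, 4, 3, 2], ![0, 2, 1, 3, 4], ![0, 2, 1, 4, 3],
      ![0, 2, 3, 1, 4], ![0, 2, 4, 1, 3], ![0, 3, 1, 2, 4], ![0, 3, 2, 1, 4]] :
        List (Fin 5 → Fin 5)),
      (∀ i j, σ i = σ j → i = j) ∧
      ∀ i j, ![![false, b12, b13, b14, b15], ![b12, false, b23, b24, b25],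
        ![b13, b23, false, b34, b35], ![b14, b24, b34, false, b45],
        ![b15, b25, b35, b45, false]] (σ i) (σ j) = true ↔ (cycleGraph 5).Adj i j := by
  decide +kernel

set_option maxRecDepth 100000 in
set_option synthInstance.maxHeartbeats 0 in
set_option synthInstance.maxSize 100000000 in
/-- A graph with seven vertices, one of them of degree four and nonadjacent to the vertices
`1` and `2`, and the others of degree three, is 3-colorable or has a Hamiltonian complement. -/
theorem three_coloring_or_cycle_of_seven : ∀ b12 b13 b14 b15 b16 : Bool,
    b12.toNat + b13.toNat + b14.toNat + b15.toNat + b16.toNat = 3 →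
    ∀ b23 b24 b25 b26 : Bool, b12.toNat + b23.toNat + b24.toNat + b25.toNat + b26.toNat = 3 →
    ∀ b34 b35 b36 : Bool, b13.toNat + b23.toNat + b34.toNat + b35.toNat + b36.toNat = 2 →
    ∀ b45 b46 : Bool, b14.toNat + b24.toNat + b34.toNat + b45.toNat + b46.toNat = 2 →
    ∀ b56 : Bool, b15.toNat + b25.toNat + b35.toNat + b45.toNat + b56.toNat = 2 →
    b16.toNat + b26.toNat + b36.toNat + b46.toNat + b56.toNat = 2 →
      (∃ c1 : Fin 3,
      ∃ c2 : Fin 3, (b12 = true → c2 ≠ c1) ∧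
      ∃ c3 : Fin 3, c3 ≠ 0 ∧ (b13 = true → c3 ≠ c1) ∧ (b23 = true → c3 ≠ c2) ∧
      ∃ c4 : Fin 3, c4 ≠ 0 ∧ (b14 = true → c4 ≠ c1) ∧ (b24 = true → c4 ≠ c2) ∧
        (b34 = true → c4 ≠ c3) ∧
      ∃ c5 : Fin 3, c5 ≠ 0 ∧ (b15 = true → c5 ≠ c1) ∧ (b25 = true → c5 ≠ c2) ∧
        (b35 = true → c5 ≠ c3) ∧ (b45 = true → c5 ≠ c4) ∧
      ∃ c6 : Fin 3, c6 ≠ 0 ∧ (b16 = true → c6 ≠ c1) ∧ (b26 = true → c6 ≠ c2) ∧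
        (b36 = true → c6 ≠ c3) ∧ (b46 = true → c6 ≠ c4) ∧ (b56 = true → c6 ≠ c5)) ∨
    -- In the complement, vertex `0` has only the neighbours `1` and `2`, so a Hamiltonian cycle
    -- must run `2, 0, 1`; six orders of the other vertices suffice.
    ∃ σ ∈ ([![0, 1, 5, 3, 6, 4, 2], ![0, 1, 4, 3, 6, 5, 2], ![0, 1, 4, 3, 5, 6, 2],
      ![0, 1, 3, 4, 6, 5, 2], ![0, 1, 3, 4, 5, 6, 2], ![0, 1, 3, 5, 4, 6, 2]] :
        List (Fin 7 → Fin 7)),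
      (∀ i j, σ i = σ j → i = j) ∧
      ∀ i, ![![false, false, false, true, true, true, true],
        ![false, false, b12, b13, b14, b15, b16], ![false, b12, false, b23, b24, b25, b26],
        ![true, b13, b23, false, b34, b35, b36], ![true, b14, b24, b34, false, b45, b46],
        ![true, b15, b25, b35, b45, false, b56],
        ![true, b16, b26, b36, b46, b56, false]] (σ i) (σ (i + 1)) = false := by
  decide +kernel

/-! ### Transfer to labelled graphs. -/

section Labelling

variable {V : Type*} {G : SimpleGraph V} [DecidableRel G.Adj] {n : ℕ}

/-- The adjacency matrix of `G` along a labelling of the vertices. -/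
def adjBool (G : SimpleGraph V) [DecidableRel G.Adj] (e : Fin n ≃ V) (i j : Fin n) : Bool :=
  decide (G.Adj (e i) (e j))

theorem adjBool_iff (e : Fin n ≃ V) {i j : Fin n} :
    adjBool G e i j = true ↔ G.Adj (e i) (e j) := decide_eq_true_iff

theorem adjBool_comm (e : Fin n ≃ V) (i j : Fin n) : adjBool G e i j = adjBool G e j i := by
  simp [adjBool, G.adj_comm]

theorem adjBool_self (e : Fin n ≃ V) (i : Fin n) : adjBool G e i i = false := by
  simp [adjBool]

theorem degree_eq_sum_adjBool [Fintype V] (e : Fin n ≃ V) (i : Fin n) :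
    G.degree (e i) = ∑ j, (adjBool G e i j).toNat := by
  rw [← card_neighborFinset_eq_degree, neighborFinset_eq_filter, Finset.card_filter,
    ← e.sum_comp]
  refine Finset.sum_congr rfl fun j _ => ?_
  by_cases h : G.Adj (e i) (e j) <;> simp [adjBool, h]

theorem colorable_of_labelling (e : Fin n ≃ V) (c : Fin n → Fin 3)
    (h : ∀ i j, i < j → adjBool G e i j = true → c i ≠ c j) : G.Colorable 3 := by
  refine ⟨Coloring.mk (fun v => c (e.symm v)) fun {v w} hvw => ?_⟩
  rcases lt_trichotomy (e.symm v) (e.symm w) with hlt | heq | hlt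
  · exact h _ _ hlt (by simpa [adjBool] using hvw)
  · exact absurd (e.symm.injective heq) hvw.ne
  · exact (h _ _ hlt (by simpa [adjBool] using hvw.symm)).symm

theorem exists_labelling [Fintype V] (hn : Fintype.card V = n + 1) (x : V) :
    ∃ e : Fin (n + 1) ≃ V, e 0 = x := by
  classical
  let e := (Fintype.equivFinOfCardEq hn).symm
  exact ⟨e.trans (Equiv.swap (e 0) x), by simp⟩

theorem exists_labelling_three [Fintype V] (hn : Fintype.card V = 7) {x a b : V} (hxa : x ≠ a)
    (hxb : x ≠ b) (hab : a ≠ b) : ∃ e : Fin (7) ≃ V, e 0 = x ∧ e 1 = a ∧ e 2 = b := by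
  classical
  obtain ⟨e, he⟩ := exists_labelling hn x
  obtain ⟨e', h0, h1⟩ : ∃ e' : Fin (7) ≃ V, e' 0 = x ∧ e' 1 = a := by
    refine ⟨e.trans (Equiv.swap (e 1) a), ?_, by simp⟩
    rw [Equiv.trans_apply, he, Equiv.swap_apply_of_ne_of_ne _ hxa]
    rw [← he]
    exact fun h => absurd (e.injective h) (by decide)
  refine ⟨e'.trans (Equiv.swap (e' 2) b), ?_, ?_, by simp⟩
  · rw [Equiv.trans_apply, h0, Equiv.swap_apply_of_ne_of_ne _ hxb]
    rw [← h0]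
    exact fun h => absurd (e'.injective h) (by decide)
  · rw [Equiv.trans_apply, h1, Equiv.swap_apply_of_ne_of_ne _ hab]
    rw [← h1]
    exact fun h => absurd (e'.injective h) (by decide)

attribute [irreducible] adjBool

end Labelling

/-! ### Graphs on four to seven vertices. -/

theorem iso_top_of_card_four {V : Type*} [Fintype V] (G : SimpleGraph V) [DecidableRel G.Adj]
    (hn : Fintype.card V = 4) (h3 : ∀ v, 3 ≤ G.degree v) :
    Nonempty (G ≃g (⊤ : SimpleGraph (Fin 4))) := by
  have htop : G = ⊤ := by
    classical
    rw [eq_top_iff]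
    intro v w hvw
    have h := h3 v
    have hsub : G.neighborFinset v ⊆ Finset.univ.erase v := fun y hy =>
      Finset.mem_erase.mpr ⟨((G.mem_neighborFinset v y).mp hy).ne', Finset.mem_univ y⟩
    have heq := Finset.eq_of_subset_of_card_le hsub (by
      rw [Finset.card_erase_of_mem (Finset.mem_univ v), Finset.card_univ, hn]
      exact h)
    rw [← mem_neighborFinset, heq]
    exact Finset.mem_erase.mpr ⟨Ne.symm hvw, Finset.mem_univ w⟩
  subst htop
  exact ⟨Iso.completeGraph (Fintype.equivFinOfCardEq hn)⟩

/-- By `hx`, the vertex `x` already absorbs the whole excess `2e - 3n`. -/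
theorem degree_eq_three_of_ne {V : Type*} [Fintype V] (G : SimpleGraph V) [DecidableRel G.Adj]
    (h3 : ∀ v, 3 ≤ G.degree v) {x : V}
    (hx : 2 * G.edgeFinset.card ≤ 3 * Fintype.card V + (G.degree x - 3)) {v : V} (hv : v ≠ x) :
    G.degree v = 3 := by
  classical
  have hsum := sum_degree_sub_three G h3
  have h1 := Finset.add_sum_erase Finset.univ (fun v => G.degree v - 3) (Finset.mem_univ x)
  have h2 : G.degree v - 3 ≤ ∑ w ∈ Finset.univ.erase x, (G.degree w - 3) :=
    Finset.single_le_sum (f := fun w => G.degree w - 3) (fun _ _ => Nat.zero_le _)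
      (Finset.mem_erase.mpr ⟨hv, Finset.mem_univ v⟩)
  have := h3 v
  omega

theorem colorable_of_card_five {V : Type*} [Fintype V] (G : SimpleGraph V) [DecidableRel G.Adj]
    (hn : Fintype.card V = 5) (h3 : ∀ v, 3 ≤ G.degree v) (he : G.edgeFinset.card ≤ 8) :
    G.Colorable 3 := by
  let e := (Fintype.equivFinOfCardEq hn).symm
  have hd : ∀ i, 3 ≤ ∑ j, (adjBool G e i j).toNat := fun i => by
    rw [← degree_eq_sum_adjBool]; exact h3 _
  have hs : ∑ i, ∑ j, (adjBool G e i j).toNat = 2 * G.edgeFinset.card := by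
    rw [← G.sum_degrees_eq_twice_card_edges, ← e.sum_comp]
    simp only [degree_eq_sum_adjBool]
  have hd0 := hd 0
  have hd1 := hd 1
  have hd2 := hd 2
  have hd3 := hd 3
  have hd4 := hd 4
  simp only [Fin.sum_univ_five, adjBool_self,
    adjBool_comm e 1 0, adjBool_comm e 2 0, adjBool_comm e 3 0, adjBool_comm e 4 0,
    adjBool_comm e 2 1, adjBool_comm e 3 1, adjBool_comm e 4 1, adjBool_comm e 3 2,
    adjBool_comm e 4 2, adjBool_comm e 4 3,
    Bool.toNat_false, zero_add, add_zero] at hd0 hd1 hd2 hd3 hd4 hs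
  obtain ⟨c1, h01, c2, h02, h12, c3, h03, h13, h23, c4, h04, h14, h24, h34⟩ :=
      three_coloring_of_five (adjBool G e 0 1) (adjBool G e 0 2) (adjBool G e 0 3)
      (adjBool G e 0 4) hd0 (adjBool G e 1 2) (adjBool G e 1 3) (adjBool G e 1 4) hd1
      (adjBool G e 2 3) (adjBool G e 2 4) hd2 (adjBool G e 3 4) hd3 hd4
      (by linarith only [hs, he])
  refine colorable_of_labelling e ![0, c1, c2, c3, c4] fun i j hij hadj heq => ?_
  fin_cases i <;> fin_cases j <;> first
    | exact absurd hij (by decide) | exact h01 hadj heq.symm | exact h02 hadj heq.symm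
    | exact h03 hadj heq.symm | exact h04 hadj heq.symm | exact h12 hadj heq.symm
    | exact h13 hadj heq.symm | exact h14 hadj heq.symm | exact h23 hadj heq.symm
    | exact h24 hadj heq.symm | exact h34 hadj heq.symm

theorem colorable_of_card_six {V : Type*} [Fintype V] (G : SimpleGraph V) [DecidableRel G.Adj]
    (hn : Fintype.card V = 6) (h3 : ∀ v, 3 ≤ G.degree v) (h4 : ∀ v, G.degree v ≤ 4)
    (he : G.edgeFinset.card ≤ 10) : G.Colorable 3 := by
  let e := (Fintype.equivFinOfCardEq hn).symm
  have hd : ∀ i, 3 ≤ ∑ j, (adjBool G e i j).toNat := fun i => by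
    rw [← degree_eq_sum_adjBool]; exact h3 _
  have hu : ∀ i, ∑ j, (adjBool G e i j).toNat ≤ 4 := fun i => by
    rw [← degree_eq_sum_adjBool]; exact h4 _
  have hs : ∑ i, ∑ j, (adjBool G e i j).toNat = 2 * G.edgeFinset.card := by
    rw [← G.sum_degrees_eq_twice_card_edges, ← e.sum_comp]
    simp only [degree_eq_sum_adjBool]
  have hu0 := hu 0
  have hu1 := hu 1
  have hu2 := hu 2
  have hu3 := hu 3
  have hu4 := hu 4
  have hu5 := hu 5
  have hd0 := hd 0
  have hd1 := hd 1
  have hd2 := hd 2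
  have hd3 := hd 3
  have hd4 := hd 4
  have hd5 := hd 5
  simp only [Fin.sum_univ_six, adjBool_self,
    adjBool_comm e 1 0, adjBool_comm e 2 0, adjBool_comm e 3 0, adjBool_comm e 4 0,
    adjBool_comm e 5 0, adjBool_comm e 2 1, adjBool_comm e 3 1, adjBool_comm e 4 1,
    adjBool_comm e 5 1, adjBool_comm e 3 2, adjBool_comm e 4 2, adjBool_comm e 5 2,
    adjBool_comm e 4 3, adjBool_comm e 5 3, adjBool_comm e 5 4,
    Bool.toNat_false, zero_add, add_zero] at hd0 hd1 hd2 hd3 hd4 hd5 hu0 hu1 hu2 hu3 hu4 hu5 hs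
  obtain ⟨c1, h01, c2, h02, h12, c3, h03, h13, h23, c4, h04, h14, h24, h34, c5, h05,
    h15, h25, h35, h45⟩ :=
      three_coloring_of_six (adjBool G e 0 1) (adjBool G e 0 2) (adjBool G e 0 3)
      (adjBool G e 0 4) (adjBool G e 0 5) ⟨hd0, hu0⟩ (adjBool G e 1 2) (adjBool G e 1 3)
      (adjBool G e 1 4) (adjBool G e 1 5) ⟨hd1, hu1⟩ (adjBool G e 2 3) (adjBool G e 2 4)
      (adjBool G e 2 5) ⟨hd2, hu2⟩ (adjBool G e 3 4) (adjBool G e 3 5) ⟨hd3, hu3⟩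
      (adjBool G e 4 5) ⟨hd4, hu4⟩ ⟨hd5, hu5⟩ (by linarith only [hs, he])
  refine colorable_of_labelling e ![0, c1, c2, c3, c4, c5] fun i j hij hadj heq => ?_
  fin_cases i <;> fin_cases j <;> first
    | exact absurd hij (by decide) | exact h01 hadj heq.symm | exact h02 hadj heq.symm
    | exact h03 hadj heq.symm | exact h04 hadj heq.symm | exact h05 hadj heq.symm
    | exact h12 hadj heq.symm | exact h13 hadj heq.symm | exact h14 hadj heq.symm
    | exact h15 hadj heq.symm | exact h23 hadj heq.symm | exact h24 hadj heq.symm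
    | exact h25 hadj heq.symm | exact h34 hadj heq.symm | exact h35 hadj heq.symm
    | exact h45 hadj heq.symm

theorem iso_wheelGraph_of_degree_five {V : Type*} [Fintype V] (G : SimpleGraph V)
    [DecidableRel G.Adj] (hn : Fintype.card V = 6) (h3 : ∀ v, 3 ≤ G.degree v)
    {x : V} (hx : 5 ≤ G.degree x) (he : G.edgeFinset.card ≤ 10) :
    Nonempty (G ≃g wheelGraph 6) := by
  obtain ⟨e, he0⟩ : ∃ e : Fin 6 ≃ V, e 0 = x := exists_labelling hn x
  -- The total excess is at most 20 - 18 = 2, all of it at the hub; removing the hub leaves a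
  -- 2-regular rim.
  have hd : ∀ i, i ≠ 0 → ∑ j, (adjBool G e i j).toNat = 3 := fun i hi => by
    rw [← degree_eq_sum_adjBool]
    exact degree_eq_three_of_ne G h3 (x := x) (by omega)
      fun h => hi (e.injective (h.trans he0.symm))
  have hub : ∀ j : Fin 6, j ≠ 0 → adjBool G e 0 j = true := by
    classical
    intro j hj
    rw [adjBool_iff, he0]
    by_contra hne
    have hmem : e j ∈ Gᶜ.neighborFinset x := by
      rw [mem_neighborFinset, compl_adj]
      exact ⟨fun h => hj (e.injective (h.symm.trans he0.symm)), hne⟩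
    have := Finset.card_pos.mpr ⟨_, hmem⟩
    rw [card_neighborFinset_eq_degree, degree_compl, hn] at this
    omega
  have hb1 := hub 1 (by decide)
  have hb2 := hub 2 (by decide)
  have hb3 := hub 3 (by decide)
  have hb4 := hub 4 (by decide)
  have hb5 := hub 5 (by decide)
  have hd1 := hd 1 (by decide)
  have hd2 := hd 2 (by decide)
  have hd3 := hd 3 (by decide)
  have hd4 := hd 4 (by decide)
  have hd5 := hd 5 (by decide)
  simp only [Fin.sum_univ_six, adjBool_self,
    adjBool_comm e 1 0, adjBool_comm e 2 0, adjBool_comm e 3 0, adjBool_comm e 4 0,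
    adjBool_comm e 5 0, adjBool_comm e 2 1, adjBool_comm e 3 1, adjBool_comm e 4 1,
    adjBool_comm e 5 1, adjBool_comm e 3 2, adjBool_comm e 4 2, adjBool_comm e 5 2,
    adjBool_comm e 4 3, adjBool_comm e 5 3, adjBool_comm e 5 4,
    hb1, hb2, hb3, hb4, hb5, Bool.toNat_false, add_zero, Bool.toNat_true] at hd1 hd2 hd3 hd4 hd5
  obtain ⟨σ, -, hσ, hadj⟩ :=
      five_cycle_of_two_regular (adjBool G e 1 2) (adjBool G e 1 3) (adjBool G e 1 4)
      (adjBool G e 1 5) (adjBool G e 2 3) (adjBool G e 2 4) (adjBool G e 2 5) (adjBool G e 3 4)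
      (adjBool G e 3 5) (adjBool G e 4 5) (by linarith only [hd1]) (by linarith only [hd2])
      (by linarith only [hd3]) (by linarith only [hd4]) (by linarith only [hd5])
  have hrim : ∀ i j : Fin 5, G.Adj (e (σ i).succ) (e (σ j).succ) ↔ (cycleGraph 5).Adj i j := by
    intro i j
    rw [← hadj i j, ← adjBool_iff]
    generalize σ i = a
    generalize σ j = b
    fin_cases a <;> fin_cases b <;> first
    | exact Iff.rfl
    | exact iff_of_eq (congrArg (· = true) (adjBool_self e _))
    | exact iff_of_eq (congrArg (· = true) (adjBool_comm e _ _))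
  let f : Option (Fin 5) → V := fun o => o.elim (e 0) fun i => e (σ i).succ
  have hf : Function.Bijective f := by
    rw [Fintype.bijective_iff_injective_and_card]
    refine ⟨?_, by simp [hn]⟩
    rintro (_ | i) (_ | j) hij
    · rfl
    · exact absurd (e.injective hij) (Fin.succ_ne_zero _).symm
    · exact absurd (e.injective hij) (Fin.succ_ne_zero _)
    · exact congrArg some (hσ i j (Fin.succ_injective _ (e.injective hij)))
  refine ⟨RelIso.symm ⟨Equiv.ofBijective f hf, ?_⟩⟩
  rintro (_ | i) (_ | j)
  · exact iff_of_false (G.irrefl) id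
  · exact iff_of_true ((adjBool_iff e).mp (hub _ (Fin.succ_ne_zero _))) trivial
  · exact iff_of_true ((adjBool_iff e).mp (hub _ (Fin.succ_ne_zero _))).symm trivial
  · exact hrim i j

theorem colorable_or_isCyclicOrder_compl_of_card_seven {V : Type*} [Fintype V]
    (G : SimpleGraph V) [DecidableRel G.Adj] (hn : Fintype.card V = 7)
    (h3 : ∀ v, 3 ≤ G.degree v) (he : G.edgeFinset.card ≤ 11) :
    G.Colorable 3 ∨ ∃ g, IsCyclicOrder Gᶜ 7 g := by
  classical
  have hsum := sum_degree_sub_three G h3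
  obtain ⟨x, hx⟩ : ∃ x, 4 ≤ G.degree x := by
    by_contra! hlt
    have : ∑ v, (G.degree v - 3) = 0 := Finset.sum_eq_zero fun v _ => by
      have := hlt v
      omega
    omega
  -- The degree sum is at least 21 and at most 22, so the total excess is at most 1.
  have hx4 : G.degree x = 4 := by
    have : G.degree x - 3 ≤ ∑ v, (G.degree v - 3) :=
      Finset.single_le_sum (f := fun v => G.degree v - 3) (fun _ _ => Nat.zero_le _)
        (Finset.mem_univ x)
    omega
  obtain ⟨a, b, hab, hnb⟩ : ∃ a b, a ≠ b ∧ Gᶜ.neighborFinset x = {a, b} := by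
    rw [← Finset.card_eq_two, card_neighborFinset_eq_degree, degree_compl, hn, hx4]
  have ha : Gᶜ.Adj x a := by rw [← mem_neighborFinset, hnb]; simp
  have hb : Gᶜ.Adj x b := by rw [← mem_neighborFinset, hnb]; simp
  obtain ⟨e, he0, he1, he2⟩ := exists_labelling_three hn ha.ne hb.ne hab
  have hd : ∀ i, i ≠ 0 → ∑ j, (adjBool G e i j).toNat = 3 := fun i hi => by
    rw [← degree_eq_sum_adjBool]
    exact degree_eq_three_of_ne G h3 (x := x) (by omega)
      fun h => hi (e.injective (h.trans he0.symm))
  have h01 : adjBool G e 0 1 = false := by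
    rw [← Bool.not_eq_true, adjBool_iff, he0, he1]
    exact ((compl_adj ..).mp ha).2
  have h02 : adjBool G e 0 2 = false := by
    rw [← Bool.not_eq_true, adjBool_iff, he0, he2]
    exact ((compl_adj ..).mp hb).2
  have hnbr : ∀ j : Fin 7, 3 ≤ j → adjBool G e 0 j = true := by
    intro j hj
    by_contra hne
    rw [adjBool_iff, he0] at hne
    have hjx : e j ≠ x := by
      rw [← he0]
      exact fun h => absurd hj (by rw [e.injective h]; decide)
    have hmem : e j ∈ Gᶜ.neighborFinset x := by
      rw [mem_neighborFinset, compl_adj]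
      exact ⟨hjx.symm, hne⟩
    rw [hnb, Finset.mem_insert, Finset.mem_singleton, ← he1, ← he2] at hmem
    rcases hmem with h | h <;> exact absurd hj (by rw [e.injective h]; decide)
  have hb3 := hnbr 3 (by decide)
  have hb4 := hnbr 4 (by decide)
  have hb5 := hnbr 5 (by decide)
  have hb6 := hnbr 6 (by decide)
  have hd1 := hd 1 (by decide)
  have hd2 := hd 2 (by decide)
  have hd3 := hd 3 (by decide)
  have hd4 := hd 4 (by decide)
  have hd5 := hd 5 (by decide)
  have hd6 := hd 6 (by decide)
  simp only [Fin.sum_univ_seven, adjBool_self,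
    adjBool_comm e 1 0, adjBool_comm e 2 0, adjBool_comm e 3 0, adjBool_comm e 4 0,
    adjBool_comm e 5 0, adjBool_comm e 6 0, adjBool_comm e 2 1, adjBool_comm e 3 1,
    adjBool_comm e 4 1, adjBool_comm e 5 1, adjBool_comm e 6 1, adjBool_comm e 3 2,
    adjBool_comm e 4 2, adjBool_comm e 5 2, adjBool_comm e 6 2, adjBool_comm e 4 3,
    adjBool_comm e 5 3, adjBool_comm e 6 3, adjBool_comm e 5 4, adjBool_comm e 6 4,
    adjBool_comm e 6 5,
    Bool.toNat_false, zero_add, add_zero, h01, h02, hb3, hb4, hb5, hb6,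
    Bool.toNat_true] at hd1 hd2 hd3 hd4 hd5 hd6
  have hcase :=
      three_coloring_or_cycle_of_seven (adjBool G e 1 2) (adjBool G e 1 3) (adjBool G e 1 4)
      (adjBool G e 1 5) (adjBool G e 1 6) hd1 (adjBool G e 2 3) (adjBool G e 2 4)
      (adjBool G e 2 5) (adjBool G e 2 6) hd2 (adjBool G e 3 4) (adjBool G e 3 5)
      (adjBool G e 3 6) (by linarith only [hd3]) (adjBool G e 4 5) (adjBool G e 4 6)
      (by linarith only [hd4]) (adjBool G e 5 6) (by linarith only [hd5])
      (by linarith only [hd6])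
  rcases hcase with ⟨c1, c2, h12, c3, h03, h13, h23, c4, h04, h14, h24, h34, c5, h05, h15,
      h25, h35, h45, c6, h06, h16, h26, h36, h46, h56⟩ | ⟨σ, -, hσ, hadj⟩
  · left
    refine colorable_of_labelling e ![0, c1, c2, c3, c4, c5, c6] fun i j hij hadj heq => ?_
    fin_cases i <;> fin_cases j <;> first
      | exact absurd hij (by decide) | exact absurd (hadj.symm.trans h01) (by decide)
      | exact absurd (hadj.symm.trans h02) (by decide) | exact h03 heq.symm | exact h04 heq.symm
      | exact h05 heq.symm | exact h06 heq.symm | exact h12 hadj heq.symm | exact h13 hadj heq.symm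
      | exact h14 hadj heq.symm | exact h15 hadj heq.symm | exact h16 hadj heq.symm
      | exact h23 hadj heq.symm | exact h24 hadj heq.symm | exact h25 hadj heq.symm
      | exact h26 hadj heq.symm | exact h34 hadj heq.symm | exact h35 hadj heq.symm
      | exact h36 hadj heq.symm | exact h45 hadj heq.symm | exact h46 hadj heq.symm
      | exact h56 hadj heq.symm
  · right
    have hsucc : ∀ i : Fin 7, i ≠ i + 1 := by decide
    have hcyc : ∀ i, Gᶜ.Adj (e (σ i)) (e (σ (i + 1))) := by
      intro i
      have hne : σ i ≠ σ (i + 1) := fun h => hsucc i (hσ _ _ h)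
      refine (compl_adj ..).mpr ⟨fun h => hne (e.injective h), ?_⟩
      rw [← adjBool_iff, Bool.not_eq_true, ← hadj i]
      generalize σ i = a
      generalize σ (i + 1) = b
      fin_cases a <;> fin_cases b <;> first
      | rfl
      | assumption
      | exact adjBool_self e _
      | exact adjBool_comm e _ _
      | exact (adjBool_comm e _ _).trans ‹_›
    -- `hcyc 6` is the closing edge, since `6 + 1 = 0` in `Fin 7`.
    refine ⟨fun i => e (σ (Fin.ofNat 7 i)), fun i hi j hj hij => ?_, fun i hi => ?_, hcyc 6⟩
    · have := congrArg Fin.val (hσ _ _ (e.injective hij))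
      simp only [Fin.val_ofNat] at this
      omega
    · have h := hcyc (Fin.ofNat 7 i)
      have hi' : Fin.ofNat 7 (i + 1) = Fin.ofNat 7 i + 1 := by
        ext
        simp [Fin.val_add]
      rwa [← hi'] at h

end SparseCritical

theorem mainTheorem2 {V : Type*} [Fintype V] [DecidableEq V]
    (G : SimpleGraph V) [DecidableRel G.Adj]
    (hcrit : SparseCritical.IsCritical G 4)
    (hK4 : ¬ Nonempty (G ≃g (⊤ : SimpleGraph (Fin 4))))
    (hW6 : ¬ Nonempty (G ≃g SparseCritical.wheelGraph 6))
    (hsparse : (G.edgeFinset.card : ℚ) < 17 * (Fintype.card V : ℚ) / 10) :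
    ∃ (a : V) (p : Gᶜ.Walk a a), p.IsHamiltonianCycle := by
  have h3 : ∀ v, 3 ≤ G.degree v := SparseCritical.le_degree_of_isCritical hcrit
  have hcol : ¬ G.Colorable 3 := by
    intro h
    have := SimpleGraph.chromaticNumber_le_iff_colorable.mpr h
    rw [hcrit.1] at this
    norm_cast at this
  have he : 10 * G.edgeFinset.card < 17 * Fintype.card V := by
    rw [lt_div_iff₀ (by norm_num)] at hsparse
    have : (10 * G.edgeFinset.card : ℚ) < 17 * Fintype.card V := by linarith
    exact_mod_cast this
  have hn : 4 ≤ Fintype.card V := by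
    -- The strict inequality `he` rules out the empty graph.
    have hpos : 0 < Fintype.card V := by omega
    obtain ⟨v⟩ := Fintype.card_pos_iff.mp hpos
    exact (h3 v).trans_lt (G.degree_lt_card_verts v)
  suffices h : ∃ g, SparseCritical.IsCyclicOrder Gᶜ (Fintype.card V) g by
    obtain ⟨g, hg⟩ := h
    exact hg.exists_isHamiltonianCycle (by omega)
  rcases Nat.lt_or_ge (Fintype.card V) 8 with hlt | hge
  -- For 5, 6 and 7 vertices, `he` rounds down to at most 8, 10 and 11 edges.
  · obtain h | h | h | h : Fintype.card V = 4 ∨ Fintype.card V = 5 ∨ Fintype.card V = 6 ∨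
        Fintype.card V = 7 := by omega
    · exact absurd (SparseCritical.iso_top_of_card_four G h h3) hK4
    · exact absurd (SparseCritical.colorable_of_card_five G h h3 (by omega)) hcol
    · by_cases h4 : ∀ v, G.degree v ≤ 4
      · exact absurd (SparseCritical.colorable_of_card_six G h h3 h4 (by omega)) hcol
      · push Not at h4
        obtain ⟨x, hx⟩ := h4
        exact absurd (SparseCritical.iso_wheelGraph_of_degree_five G h h3 hx (by omega)) hW6
    · rw [h]
      exact (SparseCritical.colorable_or_isCyclicOrder_compl_of_card_seven G h h3
        (by omega)).resolve_left hcol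
  · exact SparseCritical.exists_isCyclicOrder_compl_of_sparse G h3 hge he
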